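/- Let $(R,\mathfrak m)$ be a commutative Noetherian local ring and let $M$ be a nonzero Cohen–Macaulay $R$-module of dimension $d$, that is, a finitely generated $R$-module with $\operatorname{depth} M=\dim M=d$. Let $x_1,\dots,x_i\in\mathfrak m$ be a regular sequence on $M$. Write $H^j_{\mathfrak m}$ for local cohomology with support in $\mathfrak m$ and, for an $R$-module $X$ and an ideal $I$, write $0:_X I=\{z\in X: Iz=0\}$. Then $i\le d$ and the following hold. (1) The sequence $x_1,\dots,x_i$ is $H^d_{\mathfrak m}(M)$-coregular: with $X=H^d_{\mathfrak m}(M)$, for every $k=1,\dots,i$ multiplication by $x_k$ maps $0:_X(x_1,\dots,x_{k-1})$ onto itself. (2) There are isomorphisms of $R$-modules, one for each $n\ge 1$, $$\alpha_{i,n}: H^{d-i}_{\mathfrak m}\bigl(M/(x_1^n,\dots,x_i^n)M\bigr)\longrightarrow 0:_{H^d_{\mathfrak m}(M)}(x_1^n,\dots,x_i^n),$$ such that for every $n\ge 1$ $$\alpha_{i,n}(\nu_n(z))=x_1\cdots x_i\,\alpha_{i,n+1}(z)\qquad\text{for all } z\in H^{d-i}_{\mathfrak m}\bigl(M/(x_1^{n+1},\dots,x_i^{n+1})M\bigr),$$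 where $\nu_n: H^{d-i}_{\mathfrak m}(M/(x_1^{n+1},\dots,x_i^{n+1})M)\to H^{d-i}_{\mathfrak m}(M/(x_1^n,\dots,x_i^n)M)$ is induced by the natural surjection $M/(x_1^{n+1},\dots,x_i^{n+1})M\to M/(x_1^n,\dots,x_i^n)M$. -/

import Mathlib

open IsLocalRing CategoryTheory

universe u

namespace TopLocalCohomology

/-- The depth of a module over a local ring: the supremum of the lengths of the regular sequences
on `M` consisting of elements of the maximal ideal. -/
noncomputable def depth (R M : Type*) [CommRing R] [IsLocalRing R] [AddCommGroup M] [Module R M] :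
    ℕ∞ :=
  ⨆ (rs : List R) (_ : (∀ r ∈ rs, r ∈ maximalIdeal R) ∧ RingTheory.Sequence.IsRegular M rs),
    (rs.length : ℕ∞)

/-- A (nonzero) Cohen–Macaulay module over a local ring: a finitely generated module whose depth
equals its Krull dimension. -/
structure IsCohenMacaulay (R M : Type*) [CommRing R] [IsLocalRing R] [AddCommGroup M]
    [Module R M] : Prop where
  finite : Module.Finite R M
  nontrivial : Nontrivial M
  dim_eq_depth : Module.supportDim R M = (depth R M : WithBot ℕ∞)

/-- `ann X I` is the submodule `0 :_X I` of the elements of `X` annihilated by the ideal `I`. -/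
abbrev ann {R : Type*} (X : Type*) [CommRing R] [AddCommGroup X] [Module R X] (I : Ideal R) :
    Submodule R X :=
  Submodule.torsionBySet R X (I : Set R)

/-- The sequence `x₁, …, xₙ` of elements of the maximal ideal is `X`-coregular: multiplication by
`xₖ` is a surjection of `0 :_X (x₁, …, xₖ₋₁)` onto itself, for every `k`
(the entries of the list are numbered from `0`). -/
structure IsCoregular {R : Type*} (X : Type*) [CommRing R] [IsLocalRing R] [AddCommGroup X]
    [Module R X] (xs : List R) : Prop where
  mem : ∀ x ∈ xs, x ∈ maximalIdeal R
  surjective : ∀ (k : ℕ) (hk : k < xs.length),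
    Function.Surjective fun z : ann X (Ideal.ofList (xs.take k)) => xs[k] • z

/-- The ideal `(x₁ⁿ, …, xᵢⁿ)`. -/
def powIdeal {R : Type*} [CommRing R] (xs : List R) (n : ℕ) : Ideal R :=
  Ideal.ofList (xs.map (· ^ n))

lemma powIdeal_succ_le {R : Type*} [CommRing R] (xs : List R) (n : ℕ) :
    powIdeal xs (n + 1) ≤ powIdeal xs n := by
  refine Ideal.span_le.mpr fun r hr => ?_
  obtain ⟨x, hx, rfl⟩ := List.mem_map.mp hr
  change x ^ (n + 1) ∈ powIdeal xs n
  rw [pow_succ]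
  exact Ideal.mul_mem_right _ _ (Ideal.subset_span (List.mem_map.mpr ⟨x, hx, rfl⟩))

/-- The quotient `M / (x₁ⁿ, …, xᵢⁿ) M`. -/
abbrev QuotPow {R : Type*} (M : Type*) [CommRing R] [AddCommGroup M] [Module R M]
    (xs : List R) (n : ℕ) : Type _ :=
  M ⧸ (powIdeal xs n • ⊤ : Submodule R M)

/-- The natural surjection `M / (x₁ⁿ⁺¹, …, xᵢⁿ⁺¹) M → M / (x₁ⁿ, …, xᵢⁿ) M`, induced by the identity
of `M`. -/
def quotPowMap {R : Type*} (M : Type*) [CommRing R] [AddCommGroup M] [Module R M]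
    (xs : List R) (n : ℕ) : QuotPow M xs (n + 1) →ₗ[R] QuotPow M xs n :=
  Submodule.factor (Submodule.smul_mono_left (powIdeal_succ_le xs n))

lemma prod_smul_mem {R X : Type*} [CommRing R] [AddCommGroup X] [Module R X]
    (xs : List R) (n : ℕ) {z : X} (hz : z ∈ ann X (powIdeal xs (n + 1))) :
    xs.prod • z ∈ ann X (powIdeal xs n) := by
  rw [ann, powIdeal, Ideal.ofList, ← Submodule.torsionBySet_eq_torsionBySet_span,
    Submodule.mem_torsionBySet_iff]
  rintro ⟨r, hr⟩
  obtain ⟨x, hx, rfl⟩ := List.mem_map.mp hr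
  obtain ⟨c, hc⟩ := List.dvd_prod hx
  have h : x ^ (n + 1) • z = 0 :=
    (Submodule.mem_torsionBySet_iff _ _).mp hz
      ⟨x ^ (n + 1), Ideal.subset_span (List.mem_map.mpr ⟨x, hx, rfl⟩)⟩
  change x ^ n • xs.prod • z = 0
  rw [hc, smul_smul, ← mul_assoc, ← pow_succ, mul_comm, mul_smul, h, smul_zero]

/-- Multiplication by `x₁ ⋯ xᵢ`, as a map
`0 :_X (x₁ⁿ⁺¹, …, xᵢⁿ⁺¹) → 0 :_X (x₁ⁿ, …, xᵢⁿ)`. -/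
def annPowMap {R : Type*} (X : Type*) [CommRing R] [AddCommGroup X] [Module R X]
    (xs : List R) (n : ℕ) : ann X (powIdeal xs (n + 1)) →ₗ[R] ann X (powIdeal xs n) :=
  (LinearMap.lsmul R X xs.prod).restrict fun _ hz => prod_smul_mem xs n hz

/-- The local cohomology module `H^j_𝔪(M)` of a module over a local ring `(R, 𝔪)`. -/
noncomputable abbrev H {R : Type u} [CommRing R] [IsLocalRing R] (j : ℕ) (M : Type u)
    [AddCommGroup M] [Module R M] : ModuleCat.{u} R :=
  (localCohomology (maximalIdeal R) j).obj (ModuleCat.of R M)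

/-- The map `H^j_𝔪(M) → H^j_𝔪(N)` induced by a linear map `M → N`. -/
noncomputable abbrev Hmap {R : Type u} [CommRing R] [IsLocalRing R] (j : ℕ) {M N : Type u}
    [AddCommGroup M] [Module R M] [AddCommGroup N] [Module R N] (f : M →ₗ[R] N) :
    H (R := R) j M →ₗ[R] H (R := R) j N :=
  ((localCohomology (maximalIdeal R) j).map (ModuleCat.ofHom f)).hom

end TopLocalCohomology

/-! Let `e + i = d` and split the sequence as `ys ++ [x]`. Powers of a regular sequence in a
Noetherian local ring stay regular, so multiplication by `x ^ n` on `M/(ysⁿ)M` is injective with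
cokernel `M/(ysⁿ, xⁿ)M`. As `depth M = d`, `H^j(M) = 0` for `j < d`, and each added element lowers
this bound by one. Hence the connecting map identifies `H^e(M/(ysⁿ, xⁿ)M)` with the kernel of `x ^
n` on `H^{e+1}(M/(ysⁿ)M)`, and induction identifies the latter with a submodule of `H^d(M)`. The map
of short exact sequences from `n + 1` to `n` is `x` times the projection on the left-hand terms, so
every step contributes one factor of `x₁ ⋯ xᵢ` (`quotPowδ_naturality`, `hasAnnEquiv_append`).

For coregularity, the cokernel of `x` on `H^{e+1}(M/(ys)M)` embeds in `H^{e+1}(M/(ys, x)M)`, which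
vanishes because that quotient has dimension at most `e` (`eq_zero_of_supportDim_lt`).

The long exact sequence is obtained by passing to the colimit from `Abelian.Ext`. Since
`localCohomology` is a colimit of derived functor `Ext` groups, both versions of `Ext` are compared
on cocycles of a projective resolution (`derivedExtEquiv`). -/

/-! ### Naturality of the computation of `Ext` by projective resolutions. -/

open Limits in
lemma HomologicalComplex.homologyUnop_hom_naturality {ι V : Type*} [Category* V]
    {c : ComplexShape ι} [HasZeroMorphisms V] {K L : HomologicalComplex Vᵒᵖ c} (φ : K ⟶ L)
    (i : ι) [K.HasHomology i] [L.HasHomology i] :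
    homologyMap ((unopFunctor _ _).map φ.op) i ≫ (K.homologyUnop i).hom =
      (L.homologyUnop i).hom ≫ (homologyMap φ i).unop := by
  have h := homologyOp_hom_naturality ((unopFunctor _ _).map φ.op) i
  exact (Quiver.Hom.op_inj h).symm

namespace CategoryTheory.ProjectiveResolution
open Limits
universe w v u'
variable {R : Type*} [CommRing R] {C : Type u'} [Category.{v} C] [Abelian C] [Linear R C]
  [EnoughProjectives C]

/-- The map `Hom(K, Y) ⟶ Hom(K, Y')` of cochain complexes induced by `Y ⟶ Y'`. -/
noncomputable def linearYonedaObjMap (K : ChainComplex C ℕ) {Y Y' : C} (g : Y ⟶ Y') :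
    K.linearYonedaObj R Y ⟶ K.linearYonedaObj R Y' :=
  (HomologicalComplex.unopFunctor _ _).map
    ((NatTrans.mapHomologicalComplex (NatTrans.rightOp ((linearYoneda R C).map g)) _).app K).op

/-- The map `Hom(L, Y) ⟶ Hom(K, Y)` of cochain complexes induced by `K ⟶ L`. -/
noncomputable def linearYonedaObjPrecomp {K L : ChainComplex C ℕ} (φ : K ⟶ L) (Y : C) :
    L.linearYonedaObj R Y ⟶ K.linearYonedaObj R Y :=
  (HomologicalComplex.unopFunctor _ _).map
    ((((linearYoneda R C).obj Y).rightOp.mapHomologicalComplex _).map φ).op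

/-- `isoExt` has the shape `a ≪≫ b.symm`, with `a` from left derived functors in the opposite
category and `b` from `homologyUnop`; its naturality is the pasting of two squares. -/
lemma comp_trans_symm_hom_eq {D : Type*} [Category* D] {A A' B B' H H' : D} (m : A ⟶ A')
    (μ : B ⟶ B') (η : H ⟶ H') (a : A ≅ B) (a' : A' ≅ B') (b : H ≅ B) (b' : H' ≅ B')
    (h : m ≫ a'.hom = a.hom ≫ μ) (h' : η ≫ b'.hom = b.hom ≫ μ) :
    m ≫ (a' ≪≫ b'.symm).hom = (a ≪≫ b.symm).hom ≫ η := by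
  simp [reassoc_of% h, Iso.comp_inv_eq, h']

lemma isoExt_hom_naturality_right {X : C} (P : ProjectiveResolution X) (n : ℕ) {Y Y' : C}
    (g : Y ⟶ Y') :
    (((Ext R C n).obj (Opposite.op X)).map g) ≫ (P.isoExt n Y').hom =
      (P.isoExt n Y).hom ≫
        HomologicalComplex.homologyMap (linearYonedaObjMap (R := R) P.complex g) n := by
  have h := leftDerived_app_eq (NatTrans.rightOp ((linearYoneda R C).map g)) P n
  rw [← Iso.inv_comp_eq] at h
  refine comp_trans_symm_hom_eq _ _ _ _ _ _ _ ?_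
    (HomologicalComplex.homologyUnop_hom_naturality ((NatTrans.mapHomologicalComplex
    (NatTrans.rightOp ((linearYoneda R C).map g)) (ComplexShape.down ℕ)).app P.complex) n)
  exact congrArg Quiver.Hom.unop h

lemma isoExt_hom_naturality_left {X X' : C} (f : X ⟶ X') (P : ProjectiveResolution X)
    (P' : ProjectiveResolution X') (φ : P.complex ⟶ P'.complex)
    (comm : φ.f 0 ≫ P'.π.f 0 = P.π.f 0 ≫ f) (n : ℕ) (Y : C) :
    (((Ext R C n).map f.op).app Y) ≫ (P.isoExt n Y).hom =
      (P'.isoExt n Y).hom ≫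
        HomologicalComplex.homologyMap (linearYonedaObjPrecomp (R := R) φ Y) n := by
  exact comp_trans_symm_hom_eq _ _ _ _ _ _ _ (congrArg Quiver.Hom.unop
    (isoLeftDerivedObj_inv_naturality f P P' φ comm ((linearYoneda R C).obj Y).rightOp n))
    (HomologicalComplex.homologyUnop_hom_naturality
    ((((linearYoneda R C).obj Y).rightOp.mapHomologicalComplex (ComplexShape.down ℕ)).map φ) n)

end CategoryTheory.ProjectiveResolution

/-! ### Comparison of the derived functor `Ext` with `Abelian.Ext`. -/

namespace CategoryTheory.ProjectiveResolution
open Limits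
universe w v u'
variable {R : Type*} [CommRing R] {C : Type u'} [Category.{v} C] [Abelian C] [Linear R C]

/-- The cocycles of degree `n` of the complex `Hom(P, Y)`. -/
def homCocycles (R : Type*) [CommRing R] [Linear R C] (K : ChainComplex C ℕ) (n : ℕ) (Y : C) :
    Submodule R (K.X n ⟶ Y) :=
  LinearMap.ker (Linear.leftComp R Y (K.d (n + 1) n))

lemma mem_homCocycles {K : ChainComplex C ℕ} {n : ℕ} {Y : C} {f : K.X n ⟶ Y} :
    f ∈ homCocycles R K n Y ↔ K.d (n + 1) n ≫ f = 0 := Iff.rfl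

/-- Cocycles of `Hom(K, Y)` as cycles of the cochain complex `K.linearYonedaObj R Y`. -/
noncomputable def homCocyclesToCycles (K : ChainComplex C ℕ) (n : ℕ) (Y : C) :
    ModuleCat.of R (homCocycles R K n Y) ⟶ (K.linearYonedaObj R Y).cycles n :=
  (K.linearYonedaObj R Y).liftCycles (ModuleCat.ofHom (homCocycles R K n Y).subtype) (n + 1)
    (by simp) (by ext f; exact f.2)

lemma iCycles_homCocyclesToCycles (K : ChainComplex C ℕ) (n : ℕ) (Y : C)
   (f : homCocycles R K n Y) : 
   ((K.linearYonedaObj R Y).iCycles n).hom ((homCocyclesToCycles K n Y).hom f) = f.1 := by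
  have h : homCocyclesToCycles K n Y ≫ (K.linearYonedaObj R Y).iCycles n =
    ModuleCat.ofHom (homCocycles R K n Y).subtype :=
      HomologicalComplex.liftCycles_i _ _ _ _ _
  exact congr($(h).hom f)

lemma homCocyclesToCycles_surjective (K : ChainComplex C ℕ) (n : ℕ) (Y : C) :
    Function.Surjective (homCocyclesToCycles (R := R) K n Y).hom := by
  intro z
  have h : ((K.linearYonedaObj R Y).iCycles n).hom z ∈ homCocycles R K n Y := by
    have := (K.linearYonedaObj R Y).iCycles_d n (n + 1)
    exact congr($(this).hom z)
  refine ⟨⟨_, h⟩, ?_⟩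
  apply (ModuleCat.mono_iff_injective ((K.linearYonedaObj R Y).iCycles n)).1 inferInstance
  exact iCycles_homCocyclesToCycles K n Y ⟨_, h⟩

/-- Leaving `p` free avoids a separate statement in degree zero: a `p` that does not precede `n` has
`K.d n p = 0` and yields only the zero cocycle. -/
lemma homologyπ_eq_zero_iff (K : ChainComplex C ℕ) (n : ℕ) (Y : C) (f : homCocycles R K n Y) :
    ((K.linearYonedaObj R Y).homologyπ n).hom ((homCocyclesToCycles K n Y).hom f) = 0 ↔
      ∃ p, ∃ g : K.X p ⟶ Y, K.d n p ≫ g = f.1 := by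
  constructor
  · intro h
    have h1 := (ShortComplex.moduleCat_exact_iff _).1 (ShortComplex.exact_of_g_is_cokernel
      (.mk _ _ ((K.linearYonedaObj R Y).toCycles_comp_homologyπ _ n))
      ((K.linearYonedaObj R Y).homologyIsCokernel ((ComplexShape.up ℕ).prev n) n rfl))
    obtain ⟨g, hg⟩ := h1 _ h
    refine ⟨_, g, ?_⟩
    have h2 := congrArg ((K.linearYonedaObj R Y).iCycles n).hom hg
    rw [iCycles_homCocyclesToCycles] at h2
    rw [← h2]
    have h3 := (K.linearYonedaObj R Y).toCycles_i ((ComplexShape.up ℕ).prev n) n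
    exact congr($(h3).hom g).symm
  · rintro ⟨p, g, hg⟩
    have h4 : (homCocyclesToCycles K n Y).hom f = ((K.linearYonedaObj R Y).toCycles p n).hom g := by
      apply (ModuleCat.mono_iff_injective ((K.linearYonedaObj R Y).iCycles n)).1 inferInstance
      refine (iCycles_homCocyclesToCycles K n Y f).trans ?_
      rw [← hg]
      have h3 := (K.linearYonedaObj R Y).toCycles_i p n
      exact congr($(h3).hom g).symm
    rw [h4]
    have h5 := (K.linearYonedaObj R Y).toCycles_comp_homologyπ p n
    exact congr($(h5).hom g)

variable [EnoughProjectives C] {X : C} (P : ProjectiveResolution X) (n : ℕ) (Y : C)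

/-- The class in the derived functor `Ext` of a cocycle of a projective resolution. -/
noncomputable def derivedExtMk :
    homCocycles R P.complex n Y →ₗ[R] ((Ext R C n).obj (Opposite.op X)).obj Y :=
  (P.isoExt n Y).inv.hom ∘ₗ ((P.complex.linearYonedaObj R Y).homologyπ n).hom ∘ₗ
    (homCocyclesToCycles P.complex n Y).hom

lemma derivedExtMk_surjective : Function.Surjective (P.derivedExtMk (R := R) n Y) := by
  rw [derivedExtMk, LinearMap.coe_comp, LinearMap.coe_comp]
  refine ((ModuleCat.epi_iff_surjective (P.isoExt n Y).inv).1 inferInstance).comp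
    (((ModuleCat.epi_iff_surjective ((P.complex.linearYonedaObj R Y).homologyπ n)).1
      inferInstance).comp (homCocyclesToCycles_surjective _ _ _))

lemma derivedExtMk_eq_zero_iff (f : homCocycles R P.complex n Y) :
    P.derivedExtMk n Y f = 0 ↔ ∃ p, ∃ g : P.complex.X p ⟶ Y, P.complex.d n p ≫ g = f.1 := by
  rw [← homologyπ_eq_zero_iff]
  refine map_eq_zero_iff (P.isoExt n Y).inv.hom ?_
  exact ((ModuleCat.mono_iff_injective (P.isoExt n Y).inv).1 inferInstance)

variable [HasExt.{w} C] 

/-- The class in `Ext` of a cocycle of a projective resolution. -/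
noncomputable def extMkLinear : homCocycles R P.complex n Y →ₗ[R] Abelian.Ext X Y n where
  toFun f := P.extMk f.1 (n + 1) rfl (mem_homCocycles.1 f.2)
  map_add' f g := (P.add_extMk _ _ _ _ _ _).symm
  map_smul' r f := by
    rw [RingHom.id_apply, Abelian.Ext.smul_eq_comp_mk₀, extMk_comp_mk₀]
    congr 1
    simp

omit [EnoughProjectives C] in
lemma extMkLinear_surjective : Function.Surjective (P.extMkLinear (R := R) n Y) := by
  intro x
  obtain ⟨f, hf, h⟩ := P.extMk_surjective x (n + 1) rfl
  exact ⟨⟨f, hf⟩, h⟩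

-- The condition is that of `derivedExtMk_eq_zero_iff`: the two surjections from cocycles have the
-- same kernel, hence isomorphic targets.
omit [EnoughProjectives C] in
lemma extMkLinear_eq_zero_iff (f : homCocycles R P.complex n Y) :
    P.extMkLinear n Y f = 0 ↔ ∃ p, ∃ g : P.complex.X p ⟶ Y, P.complex.d n p ≫ g = f.1 := by
  obtain ⟨f, hf⟩ := f
  replace hf := mem_homCocycles.1 hf
  change P.extMk f (n + 1) rfl hf = 0 ↔ ∃ p, ∃ g : P.complex.X p ⟶ Y, P.complex.d n p ≫ g = f
  obtain _ | m := n
  · have h0 : (∃ p, ∃ g : P.complex.X p ⟶ Y, P.complex.d 0 p ≫ g = f) ↔ f = 0 := by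
      refine ⟨?_, fun h => ⟨0, 0, by simp [h]⟩⟩
      rintro ⟨p, g, hg⟩
      rw [← hg, P.complex.shape _ _ (by simp), zero_comp]
    rw [h0]
    refine ⟨fun h => ?_, fun h => by simp [h]⟩
    rw [← P.extEquivCohomologyClass.apply_eq_iff_eq, extEquivCohomologyClass_extMk,
      extEquivCohomologyClass_zero, CochainComplex.HomComplex.CohomologyClass.mk_eq_zero_iff,
      CochainComplex.HomComplex.Cocycle.toSingleMk_mem_coboundaries_iff _ _ _ _ _ 1 (by lia)] at h
    obtain ⟨g, hg⟩ := h
    -- In degree zero a coboundary factors through degree `1`, where the complex vanishes.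
    have hz : IsZero (P.cochainComplex.X 1) := P.cochainComplex.isZero_of_isStrictlyLE 0 1
    rw [hz.eq_zero_of_src g, comp_zero] at hg
    rw [← cancel_epi (P.cochainComplexXIso (-(0 : ℕ)) 0 rfl).hom, ← hg, comp_zero]
  · rw [P.extMk_eq_zero_iff _ _ _ _ m rfl]
    refine ⟨fun ⟨g, hg⟩ => ⟨m, g, hg⟩, ?_⟩
    rintro ⟨p, g, hg⟩
    by_cases hp : p = m
    · subst hp; exact ⟨g, hg⟩
    · refine ⟨0, ?_⟩
      rw [comp_zero, ← hg, P.complex.shape _ _ (fun h => hp (by simpa using h)), zero_comp]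

variable (R)

/-- Comparison of the derived functor `Ext` and the `Ext` of the derived category. -/
noncomputable def derivedExtEquiv :
    ((Ext R C n).obj (Opposite.op X)).obj Y ≃ₗ[R] Abelian.Ext X Y n :=
  ((P.derivedExtMk n Y).quotKerEquivOfSurjective (P.derivedExtMk_surjective n Y)).symm ≪≫ₗ
    Submodule.quotEquivOfEq _ _ (by
      ext f
      rw [LinearMap.mem_ker, LinearMap.mem_ker, derivedExtMk_eq_zero_iff,
        extMkLinear_eq_zero_iff]) ≪≫ₗ
    (P.extMkLinear n Y).quotKerEquivOfSurjective (P.extMkLinear_surjective n Y)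

variable {R}

lemma derivedExtEquiv_mk (f : homCocycles R P.complex n Y) :
    P.derivedExtEquiv R n Y (P.derivedExtMk n Y f) = P.extMkLinear n Y f := by
  have h : ((P.derivedExtMk n Y).quotKerEquivOfSurjective (P.derivedExtMk_surjective n Y)).symm
    (P.derivedExtMk n Y f) = Submodule.Quotient.mk f := by
    rw [LinearEquiv.symm_apply_eq]; rfl
  rw [derivedExtEquiv, LinearEquiv.trans_apply, LinearEquiv.trans_apply, h]
  rfl

omit [HasExt.{w} C] in
lemma derivedExtMk_comp {Y' : C} (g : Y ⟶ Y') (f : homCocycles R P.complex n Y)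
    (f' : homCocycles R P.complex n Y') (h : f'.1 = f.1 ≫ g) :
    (((Ext R C n).obj (Opposite.op X)).map g).hom (P.derivedExtMk n Y f) =
      P.derivedExtMk n Y' f' := by
  have h1 : ((linearYonedaObjMap (R := R) P.complex g).f n).hom f.1 = f'.1 := h.symm
  have h2 : (HomologicalComplex.cyclesMap (linearYonedaObjMap (R := R) P.complex g) n).hom
      ((homCocyclesToCycles P.complex n Y).hom f) =
      (homCocyclesToCycles P.complex n Y').hom f' := by
    apply (ModuleCat.mono_iff_injective ((P.complex.linearYonedaObj R Y').iCycles n)).1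
      inferInstance
    refine .trans ?_ (iCycles_homCocyclesToCycles P.complex n Y' f').symm
    rw [← h1, ← iCycles_homCocyclesToCycles]
    exact congr($(HomologicalComplex.cyclesMap_i (linearYonedaObjMap (R := R) P.complex g) n).hom _)
  apply (ModuleCat.mono_iff_injective (P.isoExt (R := R) n Y').hom).1 inferInstance
  have h3 := P.isoExt_hom_naturality_right (R := R) n g
  have h4 := HomologicalComplex.homologyπ_naturality (linearYonedaObjMap (R := R) P.complex g) n
  have h5 (z) : (P.isoExt (R := R) n Y).hom.hom ((P.isoExt n Y).inv.hom z) = z :=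
    congr($((P.isoExt (R := R) n Y).inv_hom_id).hom z)
  have h5' (z) : (P.isoExt (R := R) n Y').hom.hom ((P.isoExt n Y').inv.hom z) = z :=
    congr($((P.isoExt (R := R) n Y').inv_hom_id).hom z)
  refine (congr($(h3).hom _)).trans ?_
  refine .trans ?_ (h5' _).symm
  refine .trans (congrArg (HomologicalComplex.homologyMap
    (linearYonedaObjMap (R := R) P.complex g) n).hom (h5 _)) ?_
  refine .trans (congr($(h4).hom _)) ?_
  exact congrArg ((P.complex.linearYonedaObj R Y').homologyπ n).hom h2

omit [HasExt.{w} C] in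
lemma comp_derivedExtMk {X' : C} (a : X ⟶ X') (P' : ProjectiveResolution X')
    (φ : P.complex ⟶ P'.complex) (comm : φ.f 0 ≫ P'.π.f 0 = P.π.f 0 ≫ a)
    (f : homCocycles R P'.complex n Y)
    (f' : homCocycles R P.complex n Y) (h : f'.1 = φ.f n ≫ f.1) :
    (((Ext R C n).map a.op).app Y).hom (P'.derivedExtMk n Y f) = P.derivedExtMk n Y f' := by
  have h1 : ((linearYonedaObjPrecomp (R := R) φ Y).f n).hom f.1 = f'.1 := h.symm
  have h2 : (HomologicalComplex.cyclesMap (linearYonedaObjPrecomp (R := R) φ Y) n).hom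
      ((homCocyclesToCycles P'.complex n Y).hom f) =
      (homCocyclesToCycles P.complex n Y).hom f' := by
    apply (ModuleCat.mono_iff_injective ((P.complex.linearYonedaObj R Y).iCycles n)).1
      inferInstance
    refine .trans ?_ (iCycles_homCocyclesToCycles P.complex n Y f').symm
    rw [← h1, ← iCycles_homCocyclesToCycles]
    exact congr($(HomologicalComplex.cyclesMap_i (linearYonedaObjPrecomp (R := R) φ Y) n).hom _)
  apply (ModuleCat.mono_iff_injective (P.isoExt (R := R) n Y).hom).1 inferInstance
  have h3 := isoExt_hom_naturality_left (R := R) a P P' φ comm n Y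
  have h4 := HomologicalComplex.homologyπ_naturality (linearYonedaObjPrecomp (R := R) φ Y) n
  have h5 (z) : (P'.isoExt (R := R) n Y).hom.hom ((P'.isoExt n Y).inv.hom z) = z :=
    congr($((P'.isoExt (R := R) n Y).inv_hom_id).hom z)
  have h5' (z) : (P.isoExt (R := R) n Y).hom.hom ((P.isoExt n Y).inv.hom z) = z :=
    congr($((P.isoExt (R := R) n Y).inv_hom_id).hom z)
  refine (congr($(h3).hom _)).trans ?_
  refine .trans ?_ (h5' _).symm
  refine .trans (congrArg (HomologicalComplex.homologyMap
    (linearYonedaObjPrecomp (R := R) φ Y) n).hom (h5 _)) ?_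
  refine .trans (congr($(h4).hom _)) ?_
  exact congrArg ((P.complex.linearYonedaObj R Y).homologyπ n).hom h2

lemma derivedExtEquiv_map_right {Y' : C} (g : Y ⟶ Y')
    (x : ((Ext R C n).obj (Opposite.op X)).obj Y) :
    P.derivedExtEquiv R n Y' ((((Ext R C n).obj (Opposite.op X)).map g).hom x) =
      (P.derivedExtEquiv R n Y x).comp (Abelian.Ext.mk₀ g) (add_zero n) := by
  obtain ⟨f, rfl⟩ := P.derivedExtMk_surjective n Y x
  have hf : f.1 ≫ g ∈ homCocycles R P.complex n Y' := by
    rw [mem_homCocycles, ← Category.assoc, mem_homCocycles.1 f.2, zero_comp]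
  rw [P.derivedExtMk_comp n Y g f ⟨_, hf⟩ rfl, derivedExtEquiv_mk, derivedExtEquiv_mk]
  exact (P.extMk_comp_mk₀ f.1 (n + 1) rfl (mem_homCocycles.1 f.2) g).symm

lemma derivedExtEquiv_map_left {X' : C} (a : X ⟶ X') (P' : ProjectiveResolution X')
    (x : ((Ext R C n).obj (Opposite.op X')).obj Y) :
    P.derivedExtEquiv R n Y ((((Ext R C n).map a.op).app Y).hom x) =
      (Abelian.Ext.mk₀ a).comp (P'.derivedExtEquiv R n Y x) (zero_add n) := by
  obtain ⟨f, rfl⟩ := P'.derivedExtMk_surjective n Y x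
  let φ : Hom P P' a := { hom := lift a P P', hom_f_zero_comp_π_f_zero :=
    (lift_commutes_zero a P P').trans (by simp) }
  have hf : φ.hom.f n ≫ f.1 ∈ homCocycles R P.complex n Y := by
    rw [mem_homCocycles, ← Category.assoc, ← φ.hom.comm, Category.assoc,
      mem_homCocycles.1 f.2, comp_zero]
  rw [P.comp_derivedExtMk n Y a P' φ.hom (lift_commutes_zero a P P') f ⟨_, hf⟩ rfl,
    derivedExtEquiv_mk, derivedExtEquiv_mk]
  exact (mk₀_comp_extMk f.1 (n + 1) rfl (mem_homCocycles.1 f.2) φ).symm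

end CategoryTheory.ProjectiveResolution

/-! ### Elements of local cohomology as classes of extensions. -/

namespace localCohomology
open Limits Opposite

variable {R : Type u} [CommRing R] (J : Ideal R) (j : ℕ)

/-- The transition map `R ⧸ J ^ s ⟶ R ⧸ J ^ t` for `t ≤ s`. -/
noncomputable def powQuotMap {s t : ℕ} (h : t ≤ s) :
    ModuleCat.of R (R ⧸ J ^ s) ⟶ ModuleCat.of R (R ⧸ J ^ t) :=
  ModuleCat.ofHom (Submodule.mapQ _ _ LinearMap.id (Ideal.pow_le_pow_right h))

/-- The map to local cohomology from the derived functor `Ext` at the stage `R ⧸ J ^ t`. -/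
noncomputable def ι (t : ℕ) (N : ModuleCat.{u} R) :
    ((Ext R (ModuleCat.{u} R) j).obj (op (ModuleCat.of R (R ⧸ J ^ t)))).obj N →ₗ[R]
      (localCohomology J j).obj N :=
  ((colimit.ι (diagram (idealPowersDiagram J) j) (op (op t))).app N).hom

/-- The class in the local cohomology module of an element of `Ext (R ⧸ J ^ t) N j`. -/
noncomputable def mk (t : ℕ) (N : ModuleCat.{u} R) :
    Abelian.Ext (ModuleCat.of R (R ⧸ J ^ t)) N j →ₗ[R] (localCohomology J j).obj N :=
  ι J j t N ∘ₗ
    ((projectiveResolution (ModuleCat.of R (R ⧸ J ^ t))).derivedExtEquiv R j N).symm.toLinearMap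

variable {j}

lemma mk_derivedExtEquiv (t : ℕ) (N : ModuleCat.{u} R)
    (y : ((Ext R (ModuleCat.{u} R) j).obj (op (ModuleCat.of R (R ⧸ J ^ t)))).obj N) :
    mk J j t N ((projectiveResolution (ModuleCat.of R (R ⧸ J ^ t))).derivedExtEquiv R j N y) =
      ι J j t N y := by
  rw [mk, LinearMap.comp_apply, LinearEquiv.coe_coe, LinearEquiv.symm_apply_apply]

/-- The diagram of powers of `J` is indexed in universe `0`, not `u`. -/
instance : PreservesFilteredColimitsOfSize.{0, 0} (forget (ModuleCat.{u} R)) :=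
  preservesFilteredColimitsOfSize_shrink.{0, u, 0, u} _

lemma map_mk (t : ℕ) {N N' : ModuleCat.{u} R} (f : N ⟶ N')
    (x : Abelian.Ext (ModuleCat.of R (R ⧸ J ^ t)) N j) :
    ((localCohomology J j).map f).hom (mk J j t N x) =
      mk J j t N' (x.comp (Abelian.Ext.mk₀ f) (add_zero j)) := by
  let P := projectiveResolution (ModuleCat.of R (R ⧸ J ^ t))
  obtain ⟨y, rfl⟩ := (P.derivedExtEquiv R j N).surjective x
  rw [← P.derivedExtEquiv_map_right]
  rw [mk_derivedExtEquiv, mk_derivedExtEquiv]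
  have h := (colimit.ι (diagram (idealPowersDiagram J) j) (op (op t))).naturality f
  exact congr($(h).hom y).symm

lemma mk_comp {s t : ℕ} (h : t ≤ s) (N : ModuleCat.{u} R)
    (x : Abelian.Ext (ModuleCat.of R (R ⧸ J ^ t)) N j) :
    mk J j s N ((Abelian.Ext.mk₀ (powQuotMap J h)).comp x (zero_add j)) = mk J j t N x := by
  let P := projectiveResolution (ModuleCat.of R (R ⧸ J ^ t))
  let P' := projectiveResolution (ModuleCat.of R (R ⧸ J ^ s))
  obtain ⟨y, rfl⟩ := (P.derivedExtEquiv R j N).surjective x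
  rw [← P'.derivedExtEquiv_map_left]
  rw [mk_derivedExtEquiv, mk_derivedExtEquiv]
  have h := colimit.w (diagram (idealPowersDiagram J) j)
    (show op (op t) ⟶ op (op s) from (homOfLE h).op.op)
  exact congr(($(h).app N).hom y)

lemma mk_surjective {N : ModuleCat.{u} R} (z : (localCohomology J j).obj N) :
    ∃ t x, mk J j t N x = z := by
  obtain ⟨t, y, hy⟩ := Concrete.isColimit_exists_rep _
    (isColimitOfPreserves ((evaluation _ _).obj N)
      (colimit.isColimit (diagram (idealPowersDiagram J) j))) z
  let P := projectiveResolution (ModuleCat.of R (R ⧸ J ^ t.unop.unop))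
  exact ⟨t.unop.unop, P.derivedExtEquiv R j N y, (mk_derivedExtEquiv J _ N _).trans hy⟩

lemma exists_comp_eq_zero_of_mk_eq_zero {t : ℕ} {N : ModuleCat.{u} R}
    {x : Abelian.Ext (ModuleCat.of R (R ⧸ J ^ t)) N j} (hx : mk J j t N x = 0) :
    ∃ s, ∃ h : t ≤ s, (Abelian.Ext.mk₀ (powQuotMap J h)).comp x (zero_add j) = 0 := by
  let P := projectiveResolution (ModuleCat.of R (R ⧸ J ^ t))
  obtain ⟨y, rfl⟩ := (P.derivedExtEquiv R j N).surjective x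
  rw [mk_derivedExtEquiv] at hx
  obtain ⟨k, f, g, hfg⟩ := Concrete.isColimit_exists_of_rep_eq _
    (isColimitOfPreserves ((evaluation _ _).obj N)
      (colimit.isColimit (diagram (idealPowersDiagram J) j)))
    (i := op (op t)) (j := op (op t)) y 0 (hx.trans (map_zero _).symm)
  let P' := projectiveResolution (ModuleCat.of R (R ⧸ J ^ k.unop.unop))
  refine ⟨k.unop.unop, f.unop.unop.le, ?_⟩
  rw [← P'.derivedExtEquiv_map_left]
  rw [map_zero] at hfg
  refine (congrArg _ hfg).trans (map_zero _)

end localCohomology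

/-! ### Action of extension classes, long exact sequence and torsion. -/

namespace localCohomology
open Limits Opposite Abelian

variable {R : Type u} [CommRing R] (J : Ideal R) {j : ℕ}

section postcomp

variable {N N' N'' : ModuleCat.{u} R} {a k : ℕ} (α : Ext N N' a) (h : j + a = k)

lemma mk_comp_eq_zero {t : ℕ} {x : Ext (ModuleCat.of R (R ⧸ J ^ t)) N j}
    (hx : mk J j t N x = 0) : mk J k t N' (x.comp α h) = 0 := by
  obtain ⟨s, hs, h0⟩ := exists_comp_eq_zero_of_mk_eq_zero J hx
  rw [← mk_comp J hs, ← Ext.comp_assoc (a₁₂ := j) _ _ _ (by lia) (by lia) (by lia), h0,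
    Ext.zero_comp, map_zero]

lemma exists_mk_of_le {t s : ℕ} (hs : t ≤ s) (x : Ext (ModuleCat.of R (R ⧸ J ^ t)) N j) :
    ∃ y : Ext (ModuleCat.of R (R ⧸ J ^ s)) N j, mk J j s N y = mk J j t N x ∧
      mk J k s N' (y.comp α h) = mk J k t N' (x.comp α h) := by
  refine ⟨_, mk_comp J hs N x, ?_⟩
  rw [Ext.comp_assoc (a₂₃ := k) _ _ _ (by lia) (by lia) (by lia), mk_comp]

/-- Well-definedness of `postcomp`: brought to a common stage, the two representatives differ by a
class that dies later, and composing with `α` commutes with the transition maps. -/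
lemma mk_comp_eq {t s : ℕ} {x : Ext (ModuleCat.of R (R ⧸ J ^ t)) N j}
    {y : Ext (ModuleCat.of R (R ⧸ J ^ s)) N j} (hx : mk J j t N x = mk J j s N y) :
    mk J k t N' (x.comp α h) = mk J k s N' (y.comp α h) := by
  obtain ⟨x', h1, h2⟩ := exists_mk_of_le J α h (le_max_left t s) x
  obtain ⟨y', h3, h4⟩ := exists_mk_of_le J α h (le_max_right t s) y
  have h5 := mk_comp_eq_zero J α h (x := x' - y') (by rw [map_sub, h1, h3, hx, sub_self])
  rwa [sub_eq_add_neg, Ext.add_comp, Ext.neg_comp, ← sub_eq_add_neg, map_sub, h2, h4,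
    sub_eq_zero] at h5

/-- The map on local cohomology induced by an element of `Ext N N' a`. -/
noncomputable def postcomp : (localCohomology J j).obj N →ₗ[R] (localCohomology J k).obj N' where
  toFun z := mk J k _ N' ((mk_surjective J z).choose_spec.choose.comp α h)
  map_add' z w := by
    obtain ⟨t, x, rfl⟩ := mk_surjective J z
    obtain ⟨s, y, rfl⟩ := mk_surjective J w
    obtain ⟨x', h1, h2⟩ := exists_mk_of_le J α h (le_max_left t s) x
    obtain ⟨y', h3, h4⟩ := exists_mk_of_le J α h (le_max_right t s) y
    rw [mk_comp_eq J α h (mk_surjective J (mk J j t N x)).choose_spec.choose_spec,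
      mk_comp_eq J α h (mk_surjective J (mk J j s N y)).choose_spec.choose_spec, ← h2, ← h4,
      ← map_add, ← Ext.add_comp]
    refine mk_comp_eq J α h ?_
    rw [(mk_surjective J _).choose_spec.choose_spec, map_add, h1, h3]
  map_smul' r z := by
    obtain ⟨t, x, rfl⟩ := mk_surjective J z
    rw [mk_comp_eq J α h (mk_surjective J (mk J j t N x)).choose_spec.choose_spec,
      RingHom.id_apply, ← LinearMap.map_smul (mk J k t N'), ← Ext.smul_comp]
    refine mk_comp_eq J α h ?_
    rw [(mk_surjective J _).choose_spec.choose_spec, map_smul]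

@[simp]
lemma postcomp_mk {t : ℕ} (x : Ext (ModuleCat.of R (R ⧸ J ^ t)) N j) :
    postcomp J α h (mk J j t N x) = mk J k t N' (x.comp α h) :=
  mk_comp_eq J α h (mk_surjective J _).choose_spec.choose_spec

lemma postcomp_postcomp {b l c : ℕ} (β : Ext N' N'' b) (h' : k + b = l) (h'' : a + b = c)
    (z : (localCohomology J j).obj N) :
    postcomp J β h' (postcomp J α h z) = postcomp J (α.comp β h'') (by lia) z := by
  obtain ⟨t, x, rfl⟩ := mk_surjective J z
  rw [postcomp_mk, postcomp_mk, postcomp_mk, Ext.comp_assoc _ _ _ _ _ (by lia)]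

lemma postcomp_smul (r : R) (z : (localCohomology J j).obj N) :
    postcomp J (r • α) h z = r • postcomp J α h z := by
  obtain ⟨t, x, rfl⟩ := mk_surjective J z
  rw [postcomp_mk, postcomp_mk, Ext.comp_smul, map_smul]

lemma postcomp_zero (z : (localCohomology J j).obj N) :
    postcomp J (0 : Ext N N' a) h z = 0 := by
  obtain ⟨t, x, rfl⟩ := mk_surjective J z
  rw [postcomp_mk, Ext.comp_zero, map_zero]

lemma postcomp_id (z : (localCohomology J j).obj N) :
    postcomp J (Ext.mk₀ (𝟙 N)) (add_zero j) z = z := by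
  obtain ⟨t, x, rfl⟩ := mk_surjective J z
  rw [postcomp_mk, Ext.comp_mk₀_id]

lemma map_hom_eq_postcomp (f : N ⟶ N') :
    ((localCohomology J j).map f).hom = postcomp J (Ext.mk₀ f) (add_zero j) := by
  ext z
  obtain ⟨t, x, rfl⟩ := mk_surjective J z
  rw [postcomp_mk, map_mk]

lemma map_smul_id (r : R) (z : (localCohomology J j).obj N) :
    ((localCohomology J j).map (r • 𝟙 N)).hom z = r • z := by
  rw [map_hom_eq_postcomp, Ext.mk₀_smul, postcomp_smul, postcomp_id]

end postcomp

section exact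

variable {S : ShortComplex (ModuleCat.{u} R)} (hS : S.ShortExact)

/-- The connecting homomorphism of local cohomology. -/
noncomputable def δ (j : ℕ) :
    (localCohomology J j).obj S.X₃ →ₗ[R] (localCohomology J (j + 1)).obj S.X₁ :=
  postcomp J hS.extClass rfl

lemma δ_naturality {S' : ShortComplex (ModuleCat.{u} R)} (hS' : S'.ShortExact) (φ : S ⟶ S')
    (z : (localCohomology J j).obj S.X₃) :
    δ J hS' j (((localCohomology J j).map φ.τ₃).hom z) =
      ((localCohomology J (j + 1)).map φ.τ₁).hom (δ J hS j z) := by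
  rw [map_hom_eq_postcomp, map_hom_eq_postcomp, δ, δ, postcomp_postcomp _ _ _ _ _ (zero_add 1),
    postcomp_postcomp _ _ _ _ _ (add_zero 1), ShortComplex.ShortExact.extClass_naturality hS hS']

-- A relation in the colimit holds at some later stage `s`; exactness for `Ext` at that stage
-- supplies the preimage. `exact₃` and `exact₁` work in the same way.
include hS in
lemma exact₂ (z : (localCohomology J j).obj S.X₂)
    (hz : ((localCohomology J j).map S.g).hom z = 0) :
    ∃ w, ((localCohomology J j).map S.f).hom w = z := by
  obtain ⟨t, x, rfl⟩ := mk_surjective J z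
  rw [map_mk] at hz
  obtain ⟨s, hs, h0⟩ := exists_comp_eq_zero_of_mk_eq_zero J hz
  rw [← Ext.comp_assoc (a₁₂ := j) _ _ _ (by lia) (by lia) (by lia)] at h0
  obtain ⟨y, hy⟩ := Ext.covariant_sequence_exact₂ _ hS _ h0
  exact ⟨mk J j s _ y, by rw [map_mk, hy, mk_comp]⟩

lemma exact₃ (z : (localCohomology J j).obj S.X₃) (hz : δ J hS j z = 0) :
    ∃ w, ((localCohomology J j).map S.g).hom w = z := by
  obtain ⟨t, x, rfl⟩ := mk_surjective J z
  rw [δ, postcomp_mk] at hz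
  obtain ⟨s, hs, h0⟩ := exists_comp_eq_zero_of_mk_eq_zero J hz
  rw [← Ext.comp_assoc (a₁₂ := j) _ _ _ (by lia) (by lia) (by lia)] at h0
  obtain ⟨y, hy⟩ := Ext.covariant_sequence_exact₃ _ hS _ _ h0
  exact ⟨mk J j s _ y, by rw [map_mk, hy, mk_comp]⟩

lemma exact₁ (z : (localCohomology J (j + 1)).obj S.X₁)
    (hz : ((localCohomology J (j + 1)).map S.f).hom z = 0) : ∃ w, δ J hS j w = z := by
  obtain ⟨t, x, rfl⟩ := mk_surjective J z
  rw [map_mk] at hz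
  obtain ⟨s, hs, h0⟩ := exists_comp_eq_zero_of_mk_eq_zero J hz
  rw [← Ext.comp_assoc (a₁₂ := j + 1) _ _ _ (by lia) (by lia) (by lia)] at h0
  obtain ⟨y, hy⟩ := Ext.covariant_sequence_exact₁ _ hS _ h0 rfl
  exact ⟨mk J j s _ y, by rw [δ, postcomp_mk, hy, mk_comp]⟩

lemma map_f_δ (z : (localCohomology J j).obj S.X₃) :
    ((localCohomology J (j + 1)).map S.f).hom (δ J hS j z) = 0 := by
  rw [map_hom_eq_postcomp, δ, postcomp_postcomp _ _ _ _ _ (add_zero 1), hS.extClass_comp,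
    postcomp_zero]

include hS in
lemma map_f_zero_injective (z : (localCohomology J 0).obj S.X₁)
    (hz : ((localCohomology J 0).map S.f).hom z = 0) : z = 0 := by
  obtain ⟨t, x, rfl⟩ := mk_surjective J z
  rw [map_mk] at hz
  obtain ⟨s, hs, h0⟩ := exists_comp_eq_zero_of_mk_eq_zero J hz
  rw [← Ext.comp_assoc (a₁₂ := 0) _ _ _ (by lia) (by lia) (by lia)] at h0
  have := hS.mono_f
  have h1 := Ext.postcomp_mk₀_injective_of_mono _ S.f (h0.trans (map_zero _).symm)
  rw [← mk_comp J hs, h1, map_zero]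

end exact

/-- A class from stage `t` is killed by `J ^ t`, since `R ⧸ J ^ t` is. -/
lemma exists_pow_smul_eq_zero {N : ModuleCat.{u} R} (z : (localCohomology J j).obj N) :
    ∃ t, ∀ r ∈ J ^ t, r • z = 0 := by
  obtain ⟨t, x, rfl⟩ := mk_surjective J z
  refine ⟨t, fun r hr => ?_⟩
  have h : r • 𝟙 (ModuleCat.of R (R ⧸ J ^ t)) = 0 := by
    refine ModuleCat.hom_ext (LinearMap.ext fun y => ?_)
    obtain ⟨y, rfl⟩ := Submodule.Quotient.mk_surjective _ y
    change r • Submodule.Quotient.mk y = (0 : R ⧸ J ^ t)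
    rw [← Submodule.Quotient.mk_smul, Submodule.Quotient.mk_eq_zero]
    exact Ideal.mul_mem_right _ _ hr
  have hx : r • x = 0 := by
    rw [← Ext.mk₀_id_comp (r • x), Ext.comp_smul, ← Ext.smul_comp, ← Ext.mk₀_smul, h, Ext.mk₀_zero,
      Ext.zero_comp]
  rw [← map_smul, hx, map_zero]

end localCohomology

/-! ### Modules killed by a power of `J` have no higher local cohomology. -/

namespace localCohomology
open Limits Opposite Abelian

variable {R : Type u} [CommRing R] (J : Ideal R)

/-- Pulling the extension class back along `φ.τ₃` is pushing that of `S'` forward along `φ.τ₁`,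
which factors through `W`, where `η` dies. -/
lemma mk₀_comp_extClass_comp_eq_zero {S S' : ShortComplex (ModuleCat.{u} R)} (hS : S.ShortExact)
    (hS' : S'.ShortExact) (φ : S' ⟶ S) {N : ModuleCat.{u} R} {j k : ℕ} (hk : 1 + j = k)
    (η : Ext S.X₁ N j) (W : Submodule R S.X₁)
    (hW : (Ext.mk₀ (ModuleCat.ofHom W.subtype)).comp η (zero_add j) = 0)
    (hφ : ∀ x, φ.τ₁.hom x ∈ W) :
    (Ext.mk₀ φ.τ₃).comp (hS.extClass.comp η hk) (zero_add k) = 0 := by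
  have h : φ.τ₁ = ModuleCat.ofHom (φ.τ₁.hom.codRestrict W hφ) ≫ ModuleCat.ofHom W.subtype := rfl
  rw [← Ext.comp_assoc (a₁₂ := 1) _ _ _ (by lia) (by lia) (by lia),
    ← ShortComplex.ShortExact.extClass_naturality hS' hS,
    Ext.comp_assoc (a₂₃ := j) _ _ _ (by lia) (by lia) (by lia), h, ← Ext.mk₀_comp_mk₀,
    Ext.comp_assoc (a₂₃ := j) _ _ _ (by lia) (by lia) (by lia), hW, Ext.comp_zero, Ext.comp_zero]

lemma exists_extClass_comp_eq {S : ShortComplex (ModuleCat.{u} R)} (hS : S.ShortExact)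
    [Projective S.X₂] {N : ModuleCat.{u} R} {j : ℕ} (ξ : Ext S.X₃ N (j + 1)) :
    ∃ η : Ext S.X₁ N j, hS.extClass.comp η (add_comm 1 j) = ξ :=
  Ext.contravariant_sequence_exact₃ hS _ ξ (Ext.eq_zero_of_projective _) _

/-- The inclusion of `J ^ s A` into `A`. -/
noncomputable def powSMulInclusion (s : ℕ) (A : ModuleCat.{u} R) :
    ModuleCat.of R (J ^ s • ⊤ : Submodule R A) ⟶ A :=
  ModuleCat.ofHom (J ^ s • ⊤ : Submodule R A).subtype

/-- Dimension shifting along a finite free cover `π` of `A`; the induction varies `A` because it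
passes to `ker π`. -/
lemma exists_powSMulInclusion_comp_eq_zero [IsNoetherianRing R] {N : ModuleCat.{u} R} {k : ℕ}
    (hN : ∀ r ∈ J ^ k, ∀ n : N, r • n = 0) (j : ℕ) (A : ModuleCat.{u} R) [Module.Finite R A]
    (ξ : Ext A N j) : ∃ s, (Ext.mk₀ (powSMulInclusion J s A)).comp ξ (zero_add j) = 0 := by
  induction j generalizing A with
  | zero =>
    obtain ⟨f, rfl⟩ := Ext.addEquiv₀.symm.surjective ξ
    refine ⟨k, ?_⟩
    have h : powSMulInclusion J k A ≫ f = 0 := by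
      refine ModuleCat.hom_ext (LinearMap.ext fun ⟨a, ha⟩ => ?_)
      change f.hom a = 0
      induction ha using Submodule.smul_induction_on' with
      | smul r hr n _ => rw [map_smul, hN r hr]
      | add x _ y _ hx hy => rw [map_add, hx, hy, add_zero]
    rw [Ext.addEquiv₀_symm_apply, Ext.mk₀_comp_mk₀, h, Ext.mk₀_zero]
  | succ j ih =>
    obtain ⟨n, π, hπ⟩ := Module.Finite.exists_fin' R A
    have hS := LinearMap.shortExact_shortComplexKer hπ
    have : Projective π.shortComplexKer.X₂ := ModuleCat.projective_of_free (Pi.basisFun R (Fin n))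
    obtain ⟨η, rfl⟩ := exists_extClass_comp_eq hS ξ
    have : Module.Finite R (LinearMap.ker π) := inferInstance
    obtain ⟨s, hs⟩ := ih (ModuleCat.of R (LinearMap.ker π)) η
    -- Artin–Rees: for `u = s + c`, the part of `ker π` inside `J ^ u F`, with `F` the free cover,
    -- lies in `J ^ s • ker π`, where `η` vanishes.
    obtain ⟨c, hc⟩ := Ideal.exists_pow_inf_eq_pow_smul J (LinearMap.ker π)
    let u := s + c
    have hmap : Submodule.map π (J ^ u • ⊤) = J ^ u • ⊤ := by
      rw [Submodule.map_smul'', Submodule.map_top, LinearMap.range_eq_top.2 hπ]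
    let g : (J ^ u • ⊤ : Submodule R (Fin n → R)) →ₗ[R] (J ^ u • ⊤ : Submodule R A) :=
      π.restrict fun x hx => hmap ▸ Submodule.mem_map_of_mem hx
    have hg : Function.Surjective g := by
      rintro ⟨a, ha⟩
      rw [← hmap] at ha
      obtain ⟨x, hx, rfl⟩ := ha
      exact ⟨⟨x, hx⟩, rfl⟩
    have hS' := LinearMap.shortExact_shortComplexKer hg
    have hker (x : LinearMap.ker g) : x.1.1 ∈ LinearMap.ker π :=
      congrArg Subtype.val (LinearMap.mem_ker.1 x.2)
    let φ : g.shortComplexKer ⟶ π.shortComplexKer :=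
      { τ₁ := ModuleCat.ofHom (LinearMap.codRestrict _ (Submodule.subtype _ ∘ₗ
          Submodule.subtype _) hker)
        τ₂ := ModuleCat.ofHom (Submodule.subtype _)
        τ₃ := powSMulInclusion J u A }
    refine ⟨u, mk₀_comp_extClass_comp_eq_zero hS hS' φ _ η _ hs fun x => ?_⟩
    rw [Submodule.mem_smul_top_iff]
    have h1 : x.1.1 ∈ J ^ u • ⊤ ⊓ LinearMap.ker π := ⟨x.1.2, hker x⟩
    rw [hc u (Nat.le_add_left c s), Nat.add_sub_cancel] at h1
    exact Submodule.smul_mono le_rfl inf_le_right h1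

/-- One more shift, along `R → R ⧸ J ^ t`. Its kernel is `J ^ t`, so `J ^ s • J ^ t = J ^ (s + t)`
replaces Artin–Rees. -/
lemma exists_powQuotMap_comp_eq_zero [IsNoetherianRing R] {N : ModuleCat.{u} R} {k : ℕ}
    (hN : ∀ r ∈ J ^ k, ∀ n : N, r • n = 0) (j t : ℕ)
    (ξ : Ext (ModuleCat.of R (R ⧸ J ^ t)) N (j + 1)) :
    ∃ s, ∃ h : t ≤ s, (Ext.mk₀ (powQuotMap J h)).comp ξ (zero_add (j + 1)) = 0 := by
  have hS (t) := LinearMap.shortExact_shortComplexKer (Submodule.mkQ_surjective (J ^ t))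
  have : Projective (J ^ t).mkQ.shortComplexKer.X₂ :=
    ModuleCat.projective_of_free (Module.Basis.singleton Unit R)
  obtain ⟨η, rfl⟩ := exists_extClass_comp_eq (hS t) ξ
  obtain ⟨s, hs⟩ := exists_powSMulInclusion_comp_eq_zero J hN j _ η
  have hker (x : LinearMap.ker (J ^ (s + t)).mkQ) : x.1 ∈ J ^ (s + t) := by
    simpa only [Submodule.ker_mkQ] using x.2
  let φ : (J ^ (s + t)).mkQ.shortComplexKer ⟶ (J ^ t).mkQ.shortComplexKer :=
    { τ₁ := ModuleCat.ofHom (LinearMap.codRestrict _ (Submodule.subtype _) fun x => by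
        rw [Submodule.ker_mkQ]
        exact Ideal.pow_le_pow_right (Nat.le_add_left t s) (hker x))
      τ₂ := 𝟙 _
      τ₃ := powQuotMap J (Nat.le_add_left t s) }
  refine ⟨s + t, Nat.le_add_left t s,
    mk₀_comp_extClass_comp_eq_zero (hS t) (hS (s + t)) φ _ η _ hs fun x => ?_⟩
  rw [Submodule.mem_smul_top_iff]
  have h : J ^ s • LinearMap.ker (J ^ t).mkQ = J ^ (s + t) := by
    rw [Submodule.ker_mkQ, smul_eq_mul, pow_add]
  exact h.ge (hker x)

lemma eq_zero_of_pow_smul_eq_zero [IsNoetherianRing R] {N : ModuleCat.{u} R} {k : ℕ}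
    (hN : ∀ r ∈ J ^ k, ∀ n : N, r • n = 0) {j : ℕ} (z : (localCohomology J (j + 1)).obj N) :
    z = 0 := by
  obtain ⟨t, x, rfl⟩ := mk_surjective J z
  obtain ⟨s, hs, h0⟩ := exists_powQuotMap_comp_eq_zero J hN j t x
  rw [← mk_comp J hs, h0, map_zero]

/-! ### Vanishing below the depth and above the dimension. -/

variable {J}

/-- Every element is killed by a power of `x ∈ J`, so an injective `x` leaves only zero. -/
lemma eq_zero_of_smul_injective {N : ModuleCat.{u} R} {j : ℕ} {x : R} (hx : x ∈ J)
    (h : ∀ z : (localCohomology J j).obj N, x • z = 0 → z = 0)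
    (z : (localCohomology J j).obj N) : z = 0 := by
  obtain ⟨t, ht⟩ := exists_pow_smul_eq_zero J z
  have h0 := ht _ (Ideal.pow_mem_pow hx t)
  clear ht
  induction t with
  | zero => simpa using h0
  | succ t ih => exact ih (h _ (by rwa [smul_smul, ← pow_succ']))

lemma eq_zero_of_quotSMulTop {N : ModuleCat.{u} R} {j : ℕ} {x : R} (hx : x ∈ J)
    (hreg : IsSMulRegular N x)
    (h : ∀ z : (localCohomology J j).obj (ModuleCat.of R (QuotSMulTop x N)), z = 0)
    (z : (localCohomology J (j + 1)).obj N) : z = 0 := by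
  refine eq_zero_of_smul_injective hx (fun w hw => ?_) z
  obtain ⟨v, rfl⟩ := exact₁ J hreg.smulShortComplex_shortExact w
    ((map_smul_id J x w).trans hw)
  exact (congrArg _ (h v)).trans (map_zero _)

lemma eq_zero_of_lt_length_of_isWeaklyRegular (rs : List R) (hrs : ∀ r ∈ rs, r ∈ J)
    (N : ModuleCat.{u} R) (hreg : RingTheory.Sequence.IsWeaklyRegular N rs) {j : ℕ}
    (hj : j < rs.length) (z : (localCohomology J j).obj N) : z = 0 := by
  induction rs generalizing N j with
  | nil => simp at hj
  | cons x rs ih =>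
    rw [RingTheory.Sequence.isWeaklyRegular_cons_iff] at hreg
    obtain _ | j := j
    · exact eq_zero_of_smul_injective (hrs x (by simp)) (fun w hw => map_f_zero_injective J
        hreg.1.smulShortComplex_shortExact w ((map_smul_id J x w).trans hw)) z
    · exact eq_zero_of_quotSMulTop (hrs x (by simp)) hreg.1 (fun w =>
        ih (fun r hr => hrs r (by simp [hr])) _ hreg.2 (by simpa using hj) w) z

/-- The `𝔪`-power torsion `T` contributes nothing in positive degree, and `N ⧸ T`, if nonzero, has a
regular element in `𝔪`; dividing by it lowers the dimension. -/
lemma eq_zero_of_supportDim_lt [IsLocalRing R] [IsNoetherianRing R] (e : ℕ)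
    (N : ModuleCat.{u} R) [Module.Finite R N] (he : Module.supportDim R N ≤ e) {j : ℕ}
    (hj : e < j) (z : (localCohomology (maximalIdeal R) j).obj N) : z = 0 := by
  induction e using Nat.strong_induction_on generalizing N j with
  | _ e ih =>
  obtain _ | j := j
  · simp at hj
  -- By the ascending chain condition a single power `𝔪 ^ k` kills all `𝔪`-power torsion of `N`.
  obtain ⟨k, hk⟩ := monotone_stabilizes_iff_noetherian.2 (inferInstanceAs (IsNoetherian R N))
    ⟨fun k => Submodule.torsionBySet R N (maximalIdeal R ^ k : Ideal R),
      fun a b hab => Submodule.torsionBySet_le_torsionBySet_pow a b hab _⟩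
  let T := Submodule.torsionBySet R N (maximalIdeal R ^ k : Ideal R)
  have hT : T.mkQ.shortComplexKer.ShortExact :=
    LinearMap.shortExact_shortComplexKer T.mkQ_surjective
  have h1 (w : (localCohomology (maximalIdeal R) (j + 1)).obj T.mkQ.shortComplexKer.X₁) :
      w = 0 := by
    refine eq_zero_of_pow_smul_eq_zero _ (k := k) (fun r hr n => ?_) w
    have hn : n.1 ∈ T := by simpa only [Submodule.ker_mkQ] using n.2
    exact Subtype.ext ((Submodule.mem_torsionBySet_iff _ _).1 hn ⟨r, hr⟩)
  have h2 (w : (localCohomology (maximalIdeal R) (j + 1)).obj (ModuleCat.of R (N ⧸ T))) :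
      w = 0 := by
    -- A map from the residue field picks an element killed by `𝔪`. Its lift `y` is killed by `𝔪 ^
    -- (k + 1)`, so it lies in `T`.
    have hsub : Subsingleton (R ⧸ maximalIdeal R →ₗ[R] N ⧸ T) := by
      refine subsingleton_of_forall_eq 0 fun f => ?_
      refine Submodule.linearMap_qext _ (LinearMap.ext_ring ?_)
      obtain ⟨y, hy⟩ := T.mkQ_surjective (f (Submodule.Quotient.mk 1))
      change f (Submodule.Quotient.mk 1) = 0
      have hmy (r) (hr : r ∈ maximalIdeal R) : r • y ∈ T := by
        rw [← T.ker_mkQ, LinearMap.mem_ker, map_smul, hy, ← map_smul,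
          ← Submodule.Quotient.mk_smul, smul_eq_mul, mul_one,
          (Submodule.Quotient.mk_eq_zero _).2 hr, map_zero]
      have hyk : y ∈ Submodule.torsionBySet R N (maximalIdeal R ^ (k + 1) : Ideal R) := by
        rw [Submodule.mem_torsionBySet_iff]
        rintro ⟨a, ha⟩
        change a • y = 0
        rw [SetLike.mem_coe, pow_succ] at ha
        induction ha using Submodule.mul_induction_on' with
        | mem_mul_mem b hb r hr =>
          rw [mul_smul]
          exact (Submodule.mem_torsionBySet_iff _ _).1 (hmy r hr) ⟨b, hb⟩
        | add x _ y _ hx hy => rw [add_smul, hx, hy, add_zero]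
      have hyT : y ∈ T := (hk (k + 1) (Nat.le_succ k)).ge hyk
      rw [← hy, ← LinearMap.mem_ker, T.ker_mkQ]
      exact hyT
    obtain ⟨x, hx, hreg⟩ := IsSMulRegular.subsingleton_linearMap_iff.1 hsub
    rw [Ideal.annihilator_quotient] at hx
    obtain hs | hn := subsingleton_or_nontrivial (N ⧸ T)
    · refine eq_zero_of_smul_injective hx (fun v hv => ?_) w
      have : (1 : R) • 𝟙 (ModuleCat.of R (N ⧸ T)) = 0 :=
        ModuleCat.hom_ext (LinearMap.ext fun _ => Subsingleton.elim (α := N ⧸ T) _ _)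
      rw [← one_smul R v, ← map_smul_id, this, map_hom_eq_postcomp, Ext.mk₀_zero,
        postcomp_zero]
    · have hd := Module.supportDim_quotSMulTop_succ_eq_supportDim hreg hx
      have hd' := (Module.supportDim_le_of_surjective T.mkQ T.mkQ_surjective).trans he
      rw [← hd] at hd'
      have hne := (Module.supportDim_ne_bot_iff_nontrivial R (QuotSMulTop x (N ⧸ T))).2
        (nontrivial_quotSMulTop_of_mem_maximalIdeal (N ⧸ T) hx)
      obtain ⟨m, hm⟩ := WithBot.ne_bot_iff_exists.1 hne
      rw [← hm] at hd'
      have hle : m + 1 ≤ (e : ℕ∞) := by exact_mod_cast hd'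
      obtain ⟨n, rfl⟩ := ENat.ne_top_iff_exists.1
        (ne_top_of_le_ne_top (ENat.natCast_ne_top e) (le_self_add.trans hle))
      have hle' : n + 1 ≤ e := by exact_mod_cast hle
      exact eq_zero_of_quotSMulTop hx hreg (fun v => ih n (by lia)
        (ModuleCat.of R (QuotSMulTop x (N ⧸ T))) hm.ge (by lia) v) w
  obtain ⟨v, rfl⟩ := exact₂ _ hT z (h2 _)
  rw [h1 v, map_zero]

end localCohomology

namespace localCohomology

lemma map_smul_hom {R : Type u} [CommRing R] (J : Ideal R) {j : ℕ} {N N' : ModuleCat.{u} R}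
    (f : N ⟶ N') (r : R) (z : (localCohomology J j).obj N) :
    ((localCohomology J j).map (r • f)).hom z = r • ((localCohomology J j).map f).hom z := by
  rw [map_hom_eq_postcomp, map_hom_eq_postcomp, Abelian.Ext.mk₀_smul, postcomp_smul]

end localCohomology

/-! ### Powers of a regular sequence and the connecting maps. -/

namespace TopLocalCohomology
open RingTheory.Sequence localCohomology

/-- Raising the last entry to a power is harmless, and regular sequences here may be permuted: `x`
is moved to the end, raised to the power `n` and moved back. -/
lemma isWeaklyRegular_map_pow {R : Type*} [CommRing R] [IsLocalRing R] [IsNoetherianRing R]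
    {n : ℕ} (hn : n ≠ 0) (xs : List R) (hxs : ∀ x ∈ xs, x ∈ maximalIdeal R) (M : Type*)
    [AddCommGroup M] [Module R M] [Module.Finite R M] (h : IsWeaklyRegular M xs) :
    IsWeaklyRegular M (xs.map (· ^ n)) := by
  induction xs generalizing M with
  | nil => exact IsWeaklyRegular.nil R M
  | cons x xs ih =>
    have hxs' : ∀ y ∈ xs, y ∈ maximalIdeal R := fun y hy => hxs y (by simp [hy])
    have hx : x ∈ maximalIdeal R := hxs x (by simp)
    have hpow : ∀ y ∈ xs.map (· ^ n), y ∈ maximalIdeal R := fun y hy => by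
      obtain ⟨z, hz, rfl⟩ := List.mem_map.1 hy
      exact Ideal.pow_mem_of_mem _ (hxs' z hz) n (Nat.pos_of_ne_zero hn)
    rw [isWeaklyRegular_cons_iff] at h
    have h1 : IsWeaklyRegular M (x :: xs.map (· ^ n)) := .cons h.1 (ih hxs' _ h.2)
    have h2 : IsWeaklyRegular M (xs.map (· ^ n) ++ [x]) :=
      isWeaklyRegular_of_perm_of_subset_maximalIdeal h1
        (List.perm_append_singleton x _).symm fun y hy => by
          obtain rfl | hy := List.mem_cons.1 hy
          exacts [hx, hpow y hy]
    rw [isWeaklyRegular_append_iff, isWeaklyRegular_singleton_iff] at h2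
    have h3 : IsWeaklyRegular M (xs.map (· ^ n) ++ [x ^ n]) := by
      rw [isWeaklyRegular_append_iff, isWeaklyRegular_singleton_iff]
      exact ⟨h2.1, h2.2.pow n⟩
    refine isWeaklyRegular_of_perm_of_subset_maximalIdeal h3
        (List.perm_append_singleton (x ^ n) _) fun y hy => ?_
    rw [List.mem_append, List.mem_singleton] at hy
    obtain hy | rfl := hy
    · exact hpow y hy
    · exact Ideal.pow_mem_of_mem _ hx n (Nat.pos_of_ne_zero hn)

section

variable {R : Type u} [CommRing R]

lemma powIdeal_append_singleton (ys : List R) (x : R) (n : ℕ) :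
    powIdeal (ys ++ [x]) n = powIdeal ys n ⊔ Ideal.span {x ^ n} := by
  simp [powIdeal]

lemma mem_ann_powIdeal_append_singleton {X : Type*} [AddCommGroup X] [Module R X] (ys : List R)
    (x : R) (n : ℕ) (z : X) :
    z ∈ ann X (powIdeal (ys ++ [x]) n) ↔ z ∈ ann X (powIdeal ys n) ∧ x ^ n • z = 0 := by
  rw [powIdeal_append_singleton]
  simp only [ann, Submodule.mem_torsionBySet_iff]
  constructor
  · intro h
    exact ⟨fun a => h ⟨a, Ideal.mem_sup_left a.2⟩,
      h ⟨x ^ n, Ideal.mem_sup_right (Ideal.mem_span_singleton_self _)⟩⟩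
  · rintro ⟨h1, h2⟩ ⟨a, ha⟩
    obtain ⟨b, hb, c, hc, rfl⟩ := Submodule.mem_sup.1 ha
    obtain ⟨d, rfl⟩ := Ideal.mem_span_singleton'.1 hc
    have h3 := h1 ⟨b, hb⟩
    dsimp only at h3 ⊢
    rw [add_smul, h3, mul_smul, h2, smul_zero, add_zero]

lemma coe_annPowMap {X : Type*} [AddCommGroup X] [Module R X] (ys : List R) (n : ℕ)
    (z : ann X (powIdeal ys (n + 1))) : (annPowMap X ys n z : X) = ys.prod • (z : X) :=
  rfl

/-- `D` identifies `B` with the kernel of `x ^ n` on `A`, and `α` carries that kernel to the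
elements also killed by `x ^ n`. Used with `D` the connecting map. -/
lemma exists_annEquiv_append {A B X : Type*} [AddCommGroup A] [Module R A] [AddCommGroup B]
    [Module R B] [AddCommGroup X] [Module R X] (ys : List R) (x : R) (n : ℕ)
    (α : A ≃ₗ[R] ann X (powIdeal ys n)) (D : B →ₗ[R] A) (hD : Function.Injective D)
    (hD_smul : ∀ z, x ^ n • D z = 0) (hD_surj : ∀ w, x ^ n • w = 0 → ∃ z, D z = w) :
    ∃ β : B ≃ₗ[R] ann X (powIdeal (ys ++ [x]) n), ∀ z, (β z : X) = α (D z) := by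
  obtain ⟨f, hf⟩ : ∃ f : B →ₗ[R] X, ∀ z, f z = α (D z) :=
    ⟨Submodule.subtype _ ∘ₗ α.toLinearMap ∘ₗ D, fun _ => rfl⟩
  have hf_mem (z : B) : f z ∈ ann X (powIdeal (ys ++ [x]) n) := by
    rw [mem_ann_powIdeal_append_singleton, hf]
    exact ⟨(α (D z)).2, by rw [← Submodule.coe_smul, ← map_smul, hD_smul, map_zero,
      Submodule.coe_zero]⟩
  have hβ (z : B) : (f.codRestrict _ hf_mem z).1 = (α (D z)).1 :=
    (LinearMap.codRestrict_apply _ _ _).trans (hf z)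
  refine ⟨LinearEquiv.ofBijective (f.codRestrict _ hf_mem) ⟨fun z w hzw => ?_, ?_⟩, hβ⟩
  · refine hD (α.injective (Subtype.ext ?_))
    rw [← hβ, ← hβ, hzw]
  · rintro ⟨w, hw⟩
    obtain ⟨hw1, hw2⟩ := (mem_ann_powIdeal_append_singleton ys x n w).1 hw
    obtain ⟨v, hv⟩ := α.surjective ⟨w, hw1⟩
    obtain ⟨z, rfl⟩ := hD_surj v (by
      rw [← α.map_eq_zero_iff, map_smul, hv, Subtype.ext_iff, Submodule.coe_smul, hw2,
        Submodule.coe_zero])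
    exact ⟨z, Subtype.ext (by rw [hβ, hv])⟩

variable (M : Type u) [AddCommGroup M] [Module R M] (ys : List R) (x : R) (n : ℕ)

lemma powIdeal_smul_top_le_append :
    (powIdeal ys n • ⊤ : Submodule R M) ≤ powIdeal (ys ++ [x]) n • ⊤ :=
  Submodule.smul_mono_left ((powIdeal_append_singleton ys x n).symm ▸ le_sup_left)

/-- The projection `M / (y₁ⁿ, …, yᵢⁿ) M → M / (y₁ⁿ, …, yᵢⁿ, xⁿ) M`. -/
def quotPowAppend : QuotPow M ys n →ₗ[R] QuotPow M (ys ++ [x]) n :=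
  Submodule.factor (powIdeal_smul_top_le_append M ys x n)

/-- The complex `0 → M / (yⁿ) M → M / (yⁿ) M → M / (yⁿ, xⁿ) M → 0` whose first map is multiplication
by `xⁿ`. -/
noncomputable def quotPowComplex : ShortComplex (ModuleCat.{u} R) where
  X₁ := ModuleCat.of R (QuotPow M ys n)
  X₂ := ModuleCat.of R (QuotPow M ys n)
  X₃ := ModuleCat.of R (QuotPow M (ys ++ [x]) n)
  f := x ^ n • 𝟙 _
  g := ModuleCat.ofHom (quotPowAppend M ys x n)
  zero := by
    refine ModuleCat.hom_ext (LinearMap.ext fun q => ?_)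
    obtain ⟨m, rfl⟩ := Submodule.Quotient.mk_surjective _ q
    change Submodule.Quotient.mk (x ^ n • m) = 0
    rw [Submodule.Quotient.mk_eq_zero, powIdeal_append_singleton, Submodule.sup_smul]
    exact Submodule.mem_sup_right (Submodule.smul_mem_smul (Ideal.mem_span_singleton_self _)
      Submodule.mem_top)

lemma quotPowComplex_shortExact (h : IsSMulRegular (QuotPow M ys n) (x ^ n)) :
    (quotPowComplex M ys x n).ShortExact := by
  refine ModuleCat.shortComplex_shortExact _ (fun q => ⟨fun hq => ?_, ?_⟩) h
    (Submodule.factor_surjective (powIdeal_smul_top_le_append M ys x n))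
  · obtain ⟨m, rfl⟩ := Submodule.Quotient.mk_surjective _ q
    change Submodule.Quotient.mk m = (0 : QuotPow M (ys ++ [x]) n) at hq
    rw [Submodule.Quotient.mk_eq_zero, powIdeal_append_singleton, Submodule.sup_smul] at hq
    obtain ⟨a, ha, b, hb, rfl⟩ := Submodule.mem_sup.1 hq
    rw [Submodule.ideal_span_singleton_smul] at hb
    obtain ⟨c, -, rfl⟩ := (Submodule.mem_smul_pointwise_iff_exists _ _ _).1 hb
    refine ⟨Submodule.Quotient.mk c, ?_⟩
    change Submodule.Quotient.mk (x ^ n • c) = _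
    rw [eq_comm, Submodule.Quotient.eq, add_sub_cancel_right]
    exact ha
  · rintro ⟨p, rfl⟩
    exact congr($((quotPowComplex M ys x n).zero).hom p)

lemma quotPowMap_comp_quotPowAppend :
    quotPowMap M (ys ++ [x]) n ∘ₗ quotPowAppend M ys x (n + 1) =
      quotPowAppend M ys x n ∘ₗ quotPowMap M ys n :=
  (Submodule.factor_comp (powIdeal_smul_top_le_append M ys x (n + 1))
    (Submodule.smul_mono_left (powIdeal_succ_le (ys ++ [x]) n))).trans
    (Submodule.factor_comp (Submodule.smul_mono_left (powIdeal_succ_le ys n))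
      (powIdeal_smul_top_le_append M ys x n)).symm

lemma smul_comp_smul_id {N N' : ModuleCat.{u} R} (f : N ⟶ N') {r s : R} (h : s = x * r) :
    (x • f) ≫ (r • 𝟙 N') = (s • 𝟙 N) ≫ f := by
  rw [Linear.smul_comp, Linear.comp_smul, Linear.smul_comp, Category.comp_id, Category.id_comp,
    smul_smul, h]

/-- The transition map between the complexes `quotPowComplex`. -/
noncomputable def quotPowComplexMap : quotPowComplex M ys x (n + 1) ⟶ quotPowComplex M ys x n where
  -- The factor `x` makes the left square commute, its horizontal maps being `x ^ (n + 1)` and `x ^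
  -- n`.
  τ₁ := x • ModuleCat.ofHom (quotPowMap M ys n)
  τ₂ := ModuleCat.ofHom (quotPowMap M ys n)
  τ₃ := ModuleCat.ofHom (quotPowMap M (ys ++ [x]) n)
  comm₁₂ := smul_comp_smul_id x (ModuleCat.ofHom (quotPowMap M ys n)) (pow_succ' x n)
  comm₂₃ := ModuleCat.hom_ext (quotPowMap_comp_quotPowAppend M ys x n).symm

end

section

variable {R : Type u} [CommRing R] [IsLocalRing R] {M : Type u} [AddCommGroup M] [Module R M]
  (ys : List R) (x : R) (e : ℕ)

/-- The connecting homomorphism of the short exact sequence `quotPowComplex`. -/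
noncomputable def quotPowδ {n : ℕ} (h : IsSMulRegular (QuotPow M ys n) (x ^ n)) :
    H (R := R) e (QuotPow M (ys ++ [x]) n) →ₗ[R] H (R := R) (e + 1) (QuotPow M ys n) :=
  δ (maximalIdeal R) (quotPowComplex_shortExact M ys x n h) e

variable {e}

lemma smul_quotPowδ {n : ℕ} (h : IsSMulRegular (QuotPow M ys n) (x ^ n))
    (z : H (R := R) e (QuotPow M (ys ++ [x]) n)) : x ^ n • quotPowδ ys x e h z = 0 :=
  (map_smul_id _ _ _).symm.trans (map_f_δ _ (quotPowComplex_shortExact M ys x n h) z)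

lemma quotPowδ_injective {n : ℕ} (h : IsSMulRegular (QuotPow M ys n) (x ^ n))
    (h₀ : ∀ z : H (R := R) e (QuotPow M ys n), z = 0) :
    Function.Injective (quotPowδ ys x e h) := by
  refine (injective_iff_map_eq_zero _).2 fun z hz => ?_
  obtain ⟨w, rfl⟩ := exact₃ _ (quotPowComplex_shortExact M ys x n h) z hz
  exact (congrArg _ (h₀ w)).trans (map_zero _)

lemma exists_quotPowδ_eq {n : ℕ} (h : IsSMulRegular (QuotPow M ys n) (x ^ n))
    (w : H (R := R) (e + 1) (QuotPow M ys n)) (hw : x ^ n • w = 0) :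
    ∃ z, quotPowδ ys x e h z = w :=
  exact₁ _ (quotPowComplex_shortExact M ys x n h) w ((map_smul_id _ _ _).trans hw)

lemma quotPowδ_naturality {n : ℕ} (h : IsSMulRegular (QuotPow M ys n) (x ^ n))
    (h' : IsSMulRegular (QuotPow M ys (n + 1)) (x ^ (n + 1)))
    (z : H (R := R) e (QuotPow M (ys ++ [x]) (n + 1))) :
    quotPowδ ys x e h (Hmap e (quotPowMap M (ys ++ [x]) n) z) =
      x • Hmap (e + 1) (quotPowMap M ys n) (quotPowδ ys x e h' z) :=
  (δ_naturality _ (quotPowComplex_shortExact M ys x (n + 1) h')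
    (quotPowComplex_shortExact M ys x n h) (quotPowComplexMap M ys x n) z).trans
      (map_smul_hom _ (ModuleCat.ofHom (quotPowMap M ys n)) x _)
end

/-! ### Induction on the length of the sequence. -/

section

variable {R : Type u} [CommRing R] [IsLocalRing R] (M : Type u) [AddCommGroup M] [Module R M]

variable {M} in
lemma eq_zero_of_quotPow_append (ys : List R) (x : R) (n : ℕ)
    (h : IsSMulRegular (QuotPow M ys n) (x ^ n)) {j : ℕ}
    (h₀ : ∀ z : H (R := R) j (QuotPow M ys n), z = 0)
    (h₁ : ∀ z : H (R := R) (j + 1) (QuotPow M ys n), z = 0)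
    (z : H (R := R) j (QuotPow M (ys ++ [x]) n)) : z = 0 := by
  obtain ⟨w, rfl⟩ := exact₃ _ (quotPowComplex_shortExact M ys x n h) z (h₁ _)
  exact (congrArg _ (h₀ w)).trans (map_zero _)

/-- A family of isomorphisms
`H^e(M / (x₁ⁿ, …, xᵢⁿ) M) ≃ 0 :_{H^d(M)} (x₁ⁿ, …, xᵢⁿ)` compatible with the transition maps. -/
def HasAnnEquiv (d e : ℕ) (xs : List R) : Prop :=
  ∃ α : ∀ n : ℕ, 1 ≤ n →
      (H (R := R) e (QuotPow M xs n) ≃ₗ[R] ann (H (R := R) d M) (powIdeal xs n)),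
    ∀ (n : ℕ) (hn : 1 ≤ n),
      (α n hn).toLinearMap ∘ₗ Hmap e (quotPowMap M xs n) =
        annPowMap (H (R := R) d M) xs n ∘ₗ (α (n + 1) (Nat.le_add_left 1 n)).toLinearMap

/-- The identification of `M / 0` with `M`. -/
noncomputable def quotPowNilIso (n : ℕ) :
    ModuleCat.of R (QuotPow M ([] : List R) n) ≅ ModuleCat.of R M :=
  (Submodule.quotEquivOfEqBot _ (by simp [powIdeal])).toModuleIso

lemma hasAnnEquiv_nil (d : ℕ) : HasAnnEquiv (R := R) M d d [] := by
  have hann (n : ℕ) : ann (H (R := R) d M) (powIdeal ([] : List R) n) = ⊤ := by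
    rw [eq_top_iff]
    intro z _
    rw [ann, Submodule.mem_torsionBySet_iff]
    rintro ⟨a, ha⟩
    have ha' : a = 0 := by simpa [powIdeal] using ha
    simp [ha']
  refine ⟨fun n _ => ((localCohomology (maximalIdeal R) d).mapIso
      (quotPowNilIso (R := R) M n)).toLinearEquiv ≪≫ₗ
        (LinearEquiv.ofTop (ann (H (R := R) d M) (powIdeal ([] : List R) n)) (hann n)).symm,
    fun n hn => ?_⟩
  refine LinearMap.ext fun z => Subtype.ext ?_
  have h : ModuleCat.ofHom (quotPowMap M ([] : List R) n) ≫ (quotPowNilIso (R := R) M n).hom =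
      (quotPowNilIso (R := R) M (n + 1)).hom := by
    refine ModuleCat.hom_ext (LinearMap.ext fun q => ?_)
    obtain ⟨m, rfl⟩ := Submodule.Quotient.mk_surjective _ q
    rfl
  have h' := congrArg (localCohomology (maximalIdeal R) d).map h
  rw [Functor.map_comp] at h'
  refine (congr($(h').hom z)).trans ?_
  exact (one_smul R _).symm

lemma hasAnnEquiv_append {d e : ℕ} (ys : List R) (x : R)
    (hreg : ∀ n, 1 ≤ n → IsSMulRegular (QuotPow M ys n) (x ^ n))
    (h₀ : ∀ n, 1 ≤ n → ∀ z : H (R := R) e (QuotPow M ys n), z = 0)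
    (h : HasAnnEquiv M d (e + 1) ys) : HasAnnEquiv M d e (ys ++ [x]) := by
  obtain ⟨α, hα⟩ := h
  choose β hβ using fun (n : ℕ) (hn : 1 ≤ n) =>
    exists_annEquiv_append ys x n (α n hn) (quotPowδ ys x e (hreg n hn))
      (quotPowδ_injective ys x (hreg n hn) (h₀ n hn)) (smul_quotPowδ ys x (hreg n hn))
      (exists_quotPowδ_eq ys x (hreg n hn))
  refine ⟨β, fun n hn => LinearMap.ext fun z => Subtype.ext ?_⟩
  have h1 := congrArg Subtype.val
    (LinearMap.congr_fun (hα n hn) (quotPowδ ys x e (hreg (n + 1) (Nat.le_add_left 1 n)) z))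
  rw [LinearMap.comp_apply, LinearMap.comp_apply, coe_annPowMap, LinearEquiv.coe_coe,
    LinearEquiv.coe_coe] at h1
  rw [LinearMap.comp_apply, LinearMap.comp_apply, coe_annPowMap, LinearEquiv.coe_coe,
    LinearEquiv.coe_coe, hβ, hβ,
    quotPowδ_naturality ys x (hreg n hn) (hreg (n + 1) (Nat.le_add_left 1 n)), map_smul,
    Submodule.coe_smul, h1, smul_smul, List.prod_append, List.prod_singleton, mul_comm]

-- Both claims are proved together: injectivity of the next connecting map needs the vanishing. The
-- list grows at its end, so that the new element acts on the quotient by the earlier ones.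
variable {M} in
lemma quotPow_eq_zero_and_hasAnnEquiv {d : ℕ} (hM : ∀ j < d, ∀ z : H (R := R) j M, z = 0)
    (xs : List R) (hreg : ∀ n, 1 ≤ n → IsWeaklyRegular M (xs.map (· ^ n))) (e : ℕ)
    (he : e + xs.length = d) :
    (∀ n, 1 ≤ n → ∀ j < e, ∀ z : H (R := R) j (QuotPow M xs n), z = 0) ∧
      HasAnnEquiv M d e xs := by
  induction xs using List.reverseRecOn generalizing e with
  | nil =>
    obtain rfl : e = d := by simpa using he
    refine ⟨fun n _ j hj z => ?_, hasAnnEquiv_nil M e⟩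
    refine ((localCohomology (maximalIdeal R) j).mapIso
      (quotPowNilIso (R := R) M n)).toLinearEquiv.map_eq_zero_iff.1 (hM j hj _)
  | append_singleton ys x ih =>
    have hreg' (n : ℕ) (hn : 1 ≤ n) :
        IsWeaklyRegular M (ys.map (· ^ n)) ∧ IsSMulRegular (QuotPow M ys n) (x ^ n) := by
      have := hreg n hn
      rwa [List.map_append, List.map_singleton, isWeaklyRegular_append_iff,
        isWeaklyRegular_singleton_iff] at this
    obtain ⟨h1, h2⟩ := ih (fun n hn => (hreg' n hn).1) (e + 1)
      (by rw [← he, List.length_append, List.length_singleton]; lia)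
    exact ⟨fun n hn j hj z => eq_zero_of_quotPow_append ys x n (hreg' n hn).2
      (h1 n hn j (by lia)) (h1 n hn (j + 1) (by lia)) z,
      hasAnnEquiv_append M ys x (fun n hn => (hreg' n hn).2)
        (fun n hn => h1 n hn e (Nat.lt_succ_self e)) h2⟩

variable {M}

lemma eq_zero_of_lt_depth {j : ℕ} (hj : (j : ℕ∞) < depth R M) (z : H (R := R) j M) : z = 0 := by
  rw [depth] at hj
  obtain ⟨rs, hrs⟩ := lt_iSup_iff.1 hj
  obtain ⟨⟨hmem, hreg⟩, hlt⟩ := lt_iSup_iff.1 hrs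
  exact eq_zero_of_lt_length_of_isWeaklyRegular rs hmem (ModuleCat.of R M)
    hreg.toIsWeaklyRegular (by exact_mod_cast hlt) z

lemma smul_surjective_ann [IsNoetherianRing R] [Module.Finite R M] {d : ℕ}
    [Nontrivial M]
    (hd : Module.supportDim R M = d) (hM : ∀ j < d, ∀ z : H (R := R) j M, z = 0) (ys : List R)
    (x : R) (e : ℕ) (he : e + 1 + ys.length = d)
    (hmem : ∀ y ∈ ys ++ [x], y ∈ maximalIdeal R) (hreg : IsWeaklyRegular M (ys ++ [x])) :
    Function.Surjective fun z : ann (H (R := R) d M) (Ideal.ofList ys) => x • z := by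
  have hpow (n : ℕ) (hn : 1 ≤ n) : IsWeaklyRegular M ((ys ++ [x]).map (· ^ n)) :=
    isWeaklyRegular_map_pow (Nat.one_le_iff_ne_zero.1 hn) _ hmem M hreg
  have hpow' (n : ℕ) (hn : 1 ≤ n) :
      IsWeaklyRegular M (ys.map (· ^ n)) ∧ IsSMulRegular (QuotPow M ys n) (x ^ n) := by
    have := hpow n hn
    rwa [List.map_append, List.map_singleton, isWeaklyRegular_append_iff,
      isWeaklyRegular_singleton_iff] at this
  obtain ⟨-, α, -⟩ := quotPow_eq_zero_and_hasAnnEquiv hM ys (fun n hn => (hpow' n hn).1) (e + 1) he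
  -- Only the isomorphism for exponent `1` is needed.
  have h1 : powIdeal ys 1 = Ideal.ofList ys := by simp [powIdeal]
  rw [← h1]
  have hdim : Module.supportDim R (QuotPow M (ys ++ [x]) 1) ≤ e := by
    have hmem' : ∀ y ∈ (ys ++ [x]).map (· ^ 1), y ∈ maximalIdeal R := by simpa using hmem
    have h := Module.supportDim_add_length_eq_supportDim_of_isRegular _
      (IsRegular.of_isWeaklyRegular_of_mem_maximalIdeal M hmem' (hpow 1 le_rfl))
    rw [hd, List.length_map, List.length_append, List.length_singleton] at h
    change Module.supportDim R (QuotPow M (ys ++ [x]) 1) + _ = _ at h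
    generalize Module.supportDim R (QuotPow M (ys ++ [x]) 1) = D at h
    cases D with
    | bot => exact bot_le
    | coe D =>
      have h' : D + (ys.length + 1) = (d : ℕ∞) := by exact_mod_cast h
      cases D with
      | top => simp at h'
      | coe D =>
        have h'' : D + (ys.length + 1) = d := by exact_mod_cast h'
        have h3 : D ≤ e := by lia
        exact_mod_cast h3
  intro w
  obtain ⟨u, rfl⟩ := (α 1 le_rfl).surjective w
  -- The image of `u` in `H^{e+1}(M/(ys, x)M)` vanishes for dimension reasons, so `u` is a multiple
  -- of `x`.
  obtain ⟨v, rfl⟩ : ∃ v : H (R := R) (e + 1) (QuotPow M ys 1), x ^ 1 • v = u := by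
    obtain ⟨v, hv⟩ := exact₂ _ (quotPowComplex_shortExact M ys x 1 (hpow' 1 le_rfl).2) u
      (eq_zero_of_supportDim_lt e (ModuleCat.of R (QuotPow M (ys ++ [x]) 1)) hdim
        (Nat.lt_succ_self e) _)
    exact ⟨v, (map_smul_id _ (x ^ 1) v).symm.trans hv⟩
  refine ⟨α 1 le_rfl v, ?_⟩
  dsimp only
  rw [pow_one, map_smul]

end

end TopLocalCohomology

theorem proposition2p1 (R : Type u) [CommRing R] [IsLocalRing R] [IsNoetherianRing R]
    (M : Type u) [AddCommGroup M] [Module R M] (hM : TopLocalCohomology.IsCohenMacaulay R M)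
    (d : ℕ) (hd : Module.supportDim R M = d)
    (xs : List R) (hmem : ∀ x ∈ xs, x ∈ IsLocalRing.maximalIdeal R)
    (hreg : RingTheory.Sequence.IsRegular M xs) :
    xs.length ≤ d ∧
    TopLocalCohomology.IsCoregular (TopLocalCohomology.H (R := R) d M) xs ∧
    ∃ α : ∀ n : ℕ, 1 ≤ n →
        (TopLocalCohomology.H (R := R) (d - xs.length) (TopLocalCohomology.QuotPow M xs n) ≃ₗ[R]
          TopLocalCohomology.ann (TopLocalCohomology.H (R := R) d M)
            (TopLocalCohomology.powIdeal xs n)),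
      ∀ (n : ℕ) (hn : 1 ≤ n),
        (α n hn).toLinearMap ∘ₗ
            TopLocalCohomology.Hmap (d - xs.length) (TopLocalCohomology.quotPowMap M xs n) =
          TopLocalCohomology.annPowMap (TopLocalCohomology.H (R := R) d M) xs n ∘ₗ
            (α (n + 1) (Nat.le_add_left 1 n)).toLinearMap := by
  have := hM.finite
  have := hM.nontrivial
  have hvan (j : ℕ) (hj : j < d) (z : TopLocalCohomology.H (R := R) j M) : z = 0 := by
    refine TopLocalCohomology.eq_zero_of_lt_depth ?_ z
    have h := hM.dim_eq_depth
    rw [hd] at h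
    have h' : (d : ℕ∞) = TopLocalCohomology.depth R M := by exact_mod_cast h
    rw [← h']
    exact_mod_cast hj
  have hlen : xs.length ≤ d := by
    have h := Module.supportDim_add_length_eq_supportDim_of_isRegular xs hreg
    have hne := (Module.supportDim_ne_bot_iff_nontrivial R _).2
      (hreg.quot_ofList_smul_nontrivial ⊤)
    obtain ⟨m, hm⟩ := WithBot.ne_bot_iff_exists.1 hne
    rw [← hm, hd] at h
    have h' : m + xs.length = (d : ℕ∞) := by exact_mod_cast h
    have h'' : (xs.length : ℕ∞) ≤ d := h' ▸ le_add_self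
    exact_mod_cast h''
  have hpow (ys : List R) (hys : ∀ y ∈ ys, y ∈ IsLocalRing.maximalIdeal R)
      (hw : RingTheory.Sequence.IsWeaklyRegular M ys) (n : ℕ) (hn : 1 ≤ n) :
      RingTheory.Sequence.IsWeaklyRegular M (ys.map (· ^ n)) :=
    TopLocalCohomology.isWeaklyRegular_map_pow (Nat.one_le_iff_ne_zero.1 hn) ys hys M hw
  refine ⟨hlen, ⟨hmem, fun k hk => ?_⟩, (TopLocalCohomology.quotPow_eq_zero_and_hasAnnEquiv hvan xs
    (hpow xs hmem hreg.toIsWeaklyRegular) (d - xs.length) (Nat.sub_add_cancel hlen)).2⟩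
  -- `xs.take k` followed by `xs[k]` is a prefix of `xs`, hence again weakly regular.
  exact TopLocalCohomology.smul_surjective_ann hd hvan (xs.take k) xs[k] (d - (k + 1))
    (by rw [List.length_take]; lia)
    (fun y hy => hmem y (List.mem_of_mem_take (List.take_concat_get' xs k hk ▸ hy)))
    (by
      rw [List.take_concat_get' xs k hk]
      have h := hreg.toIsWeaklyRegular
      rw [← List.take_append_drop (k + 1) xs, RingTheory.Sequence.isWeaklyRegular_append_iff] at h
      exact h.1)
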